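/- Let $P,Q\in\mathbb{R}[x,y]$ be polynomials without a non-constant common divisor, and suppose that the system $x'=P(x,y)$, $y'=Q(x,y)$ (where $'=d/dt$) has a polynomial first integral, that is, a non-constant $F\in\mathbb{R}[x,y]$ with $F_xP+F_yQ\equiv 0$, and is not Hamiltonian, that is, there is no $F\in\mathbb{R}[x,y]$ with $P=F_y$, $Q=-F_x$. Then the system is obtained from the linear saddle $\dot u=u$, $\dot v=-v$ (where $\dot{\ }=d/d\tau$) by a polynomial change of variables and a rational change of the independent variable. More precisely, there are a polynomial first integral $H$ of minimal degree, an integer $p>1$, pairwise non-associated irreducible polynomials $u_1,\dots,u_p\in\mathbb{R}[x,y]$, integers $k_1,\dots,k_p\ge 1$, at least one of which is greater than $1$, and a non-zero polynomial $G\in\mathbb{R}[x,y]$ such that the following hold. (1) The product $u_1^{k_1}\cdots u_p^{k_p}$ equals $H$ or $H^2+1$. (2) With $$K_1=\sum_{i<p}k_i\,(u_i)_x\prod_{j<p,\,j\ne i}u_j,\quad K_2=\sum_{i<p}k_i\,(u_i)_y\prod_{j<p,\,j\ne i}u_j,\quad K_3=k_p(u_p)_x,\quad K_4=k_p(u_p)_y,$$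 the polynomial $D=K_1K_4-K_2K_3$ is not zero, and $$\sum_{i=1}^{p}k_i\,(u_i)_y\prod_{j\neq i}u_j=GP,\qquad -\sum_{i=1}^{p}k_i\,(u_i)_x\prod_{j\neq i}u_j=GQ.$$ (3) Put $u=u_1^{k_1}\cdots u_{p-1}^{k_{p-1}}$, $v=u_p^{k_p}$ and $\Omega=\{(x,y)\in\mathbb{R}^2: D(x,y)\ne 0,\ G(x,y)\neq 0\}$. Every solution $(x(t),y(t))$ of the system $x'=P$, $y'=Q$ on an open interval with values in $\Omega$ becomes, after the change of the independent variable $d\tau=\frac{D}{G}\,dt$, a solution on an open interval of $\dot x=\frac{GP}{D}$, $\dot y=\frac{GQ}{D}$, and the functions $u(x(\tau),y(\tau))$, $v(x(\tau),y(\tau))$ then satisfy $\dot u=u$, $\dot v=-v$. (4) Conversely, every differentiable curve $(x(\tau),y(\tau))$ on an open interval with values in $\Omega$ along which $\dot u=u$, $\dot v=-v$ becomes, after the change of the independent variable $d\tau=\frac{D}{G}\,dt$, a solution on an open interval of the system $x'=P$, $y'=Q$. -/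

import Mathlib

open MvPolynomial

namespace PlanarSys

/-- Real polynomials in the two variables `x = X 0` and `y = X 1`. -/
abbrev Poly2 : Type := MvPolynomial (Fin 2) ℝ

/-- The real plane. -/
abbrev Plane : Type := Fin 2 → ℝ

/-- `F` is a (non-constant) polynomial first integral of `x' = P, y' = Q`. -/
def IsFirstIntegral (P Q F : Poly2) : Prop :=
  (∀ c : ℝ, F ≠ C c) ∧ pderiv 0 F * P + pderiv 1 F * Q = 0

/-- A polynomial first integral of least degree. -/
def IsMinimalFirstIntegral (P Q F : Poly2) : Prop :=
  IsFirstIntegral P Q F ∧ ∀ F' : Poly2, IsFirstIntegral P Q F' → F.totalDegree ≤ F'.totalDegree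

/-- The system `x' = P, y' = Q` is Hamiltonian (with a polynomial Hamiltonian). -/
def IsHamiltonian (P Q : Poly2) : Prop :=
  ∃ F : Poly2, P = pderiv 1 F ∧ Q = -pderiv 0 F

section Change

/- The irreducible factors `u 0, …, u n` are `u_1, …, u_p` with `p = n + 1`, so that
`u (Fin.last n)` is `u_p` and the `u i.castSucc` are `u_1, …, u_{p-1}`. -/
variable {n : ℕ} (u : Fin (n + 1) → Poly2) (k : Fin (n + 1) → ℕ)

/-- The new variable `u = u_1^{k_1} ⋯ u_{p-1}^{k_{p-1}}`. -/
noncomputable def newU : Poly2 := ∏ i : Fin n, u i.castSucc ^ k i.castSucc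

/-- The new variable `v = u_p^{k_p}`. -/
noncomputable def newV : Poly2 := u (Fin.last n) ^ k (Fin.last n)

/-- The change of variables `(x, y) ↦ (u, v)`. -/
noncomputable def coordChange (z : Plane) : Plane := ![eval z (newU u k), eval z (newV u k)]

/-- `∑_{i < p} k_i (∂_d u_i) ∏_{j < p, j ≠ i} u_j`, i.e. `K₁` for `d = 0` and `K₂` for `d = 1`. -/
noncomputable def headK (d : Fin 2) : Poly2 :=
  ∑ i : Fin n, (k i.castSucc : Poly2) * pderiv d (u i.castSucc) *
    ∏ j ∈ Finset.univ.erase i, u j.castSucc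

/-- `k_p ∂_d u_p`, i.e. `K₃` for `d = 0` and `K₄` for `d = 1`. -/
noncomputable def lastK (d : Fin 2) : Poly2 :=
  (k (Fin.last n) : Poly2) * pderiv d (u (Fin.last n))

/-- `D = K₁ K₄ - K₂ K₃`. -/
noncomputable def detD : Poly2 :=
  headK u k 0 * lastK u k 1 - headK u k 1 * lastK u k 0

/-- `∑_i k_i (∂_d u_i) ∏_{j ≠ i} u_j`, the sum being over all the factors. -/
noncomputable def fullK (d : Fin 2) : Poly2 :=
  ∑ i : Fin (n + 1), (k i : Poly2) * pderiv d (u i) * ∏ j ∈ Finset.univ.erase i, u j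

end Change

/-- The planar vector field with components `P, Q`. -/
noncomputable def vecField (P Q : Poly2) (z : Plane) : Plane := ![eval z P, eval z Q]

/-- The linear saddle `(u, v) ↦ (u, -v)`. -/
def saddle (w : Plane) : Plane := ![w 0, -w 1]

/-- The region where `D ≠ 0` and `G ≠ 0`. -/
def region (D G : Poly2) : Set Plane := {z | eval z D ≠ 0 ∧ eval z G ≠ 0}

/-- The curve `γ` solves the autonomous system with vector field `Y` on `I`. -/
def SolvesOn (Y : Plane → Plane) (γ : ℝ → Plane) (I : Set ℝ) : Prop :=
  ∀ t ∈ I, HasDerivAt γ (Y (γ t)) t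

/-- An open (possibly unbounded or empty) interval of the real line. -/
def IsOpenInterval (I : Set ℝ) : Prop := IsOpen I ∧ I.OrdConnected

/-- The curves `γ` (with time `t ∈ I`) and `η` (with time `τ ∈ J`) are the same curve up to the
change of time `τ = σ t` given by `dτ = ρ dt`. -/
def IsTimeChange (ρ : Plane → ℝ) (γ : ℝ → Plane) (I : Set ℝ) (η : ℝ → Plane) (J : Set ℝ) : Prop :=
  ∃ σ : ℝ → ℝ, Set.BijOn σ I J ∧ (∀ t ∈ I, HasDerivAt σ (ρ (γ t)) t) ∧ ∀ t ∈ I, γ t = η (σ t)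

end PlanarSys

open PlanarSys

/-! For a first integral `H` of least degree, coprimality of `P` and `Q` gives `H_y = R P`, `H_x =
-R Q`. The system is not Hamiltonian, so `R` is not a unit and has an irreducible factor `f`, which
divides both partials of `H`. Hence `H` is locally constant along the curve `f = 0`: its class
modulo `f` is algebraic over `ℝ`, with minimal polynomial of degree 1 or 2. After an affine change
of `H` (`exists_dvd_affine`), `f` divides `W = H` or `W = H ^ 2 + 1`; since it also divides the
partials of `W`, it divides `W` twice. Factoring `W` and placing the multiple factor last gives
`exists_normal_form`.

Now `W = u v` is a first integral, so `u` and `v` have opposite logarithmic derivatives along the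
flow. Cleared of denominators, these are `D / G` and `-D / G` (`lieDer_newU`, `lieDer_newV`), and
the time change `dτ = (D / G) dt` yields the saddle. If `p = 1` or `D = 0`, then `u_p` would be a
first integral, which its multiplicity and the minimality of `H` exclude
(`not_isFirstIntegral_last`).

Conversely, the saddle equations form a linear system for the velocity with determinant `D`, solved
by Cramer's rule (`deriv_eq_of_saddle`). Points where `u` or `v` vanishes need separate care, as
logarithms are unavailable there. -/

namespace PlanarSys

/-! ### Algebraic relations modulo an irreducible polynomial -/

section Algebra

/-- Every nonzero polynomial in `n + 1` elements divisible by `f` in which `f` is the first element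
gives a nonzero polynomial in the other `n` elements that is divisible by `f`. -/
lemma exists_dvd_aeval_of_aeval_cons_eq_zero {n : ℕ} {f : Poly2} (hf : f ≠ 0) (a : Fin n → Poly2)
    {q : MvPolynomial (Fin (n + 1)) ℝ} (hq : q ≠ 0)
    (h : aeval (Fin.cons f a : Fin (n + 1) → Poly2) q = 0) :
    ∃ r : MvPolynomial (Fin n) ℝ, r ≠ 0 ∧ f ∣ aeval a r := by
  have key : ∀ q : MvPolynomial (Fin (n + 1)) ℝ,
      aeval (Fin.cons f a : Fin (n + 1) → Poly2) q
        = (finSuccEquiv ℝ n q).eval₂ (aeval a : MvPolynomial (Fin n) ℝ →ₐ[ℝ] Poly2).toRingHom f := by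
    intro q
    induction q using MvPolynomial.induction_on with
    | C c => simp [finSuccEquiv_apply]
    | add p q hp hq => rw [map_add, map_add, Polynomial.eval₂_add, hp, hq]
    | mul_X p i hp =>
      rw [map_mul, map_mul, Polynomial.eval₂_mul, hp]
      congr 1
      refine Fin.cases ?_ (fun j => ?_) i
      · simp [finSuccEquiv_X_zero]
      · simp [finSuccEquiv_X_succ]
  rw [key] at h
  have hQ : finSuccEquiv ℝ n q ≠ 0 := by simpa using hq
  -- Removing the largest power of the first variable leaves a relation whose constant term in that
  -- variable is non-zero; modulo `f` only this term survives.
  obtain ⟨Q', hQ', hnd⟩ := Polynomial.exists_eq_pow_rootMultiplicity_mul_and_not_dvd _ hQ 0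
  rw [hQ'] at h
  rw [Polynomial.eval₂_mul] at h
  simp only [map_zero, sub_zero, Polynomial.eval₂_pow, Polynomial.eval₂_X] at h
  have h0 := (mul_eq_zero.mp h).resolve_left (pow_ne_zero _ hf)
  refine ⟨Q'.coeff 0, ?_, ?_⟩
  · intro hc
    apply hnd
    simpa [Polynomial.X_dvd_iff] using hc
  · rw [← Polynomial.divX_mul_X_add Q', Polynomial.eval₂_add, Polynomial.eval₂_mul] at h0
    simp only [Polynomial.eval₂_X, Polynomial.eval₂_C] at h0
    refine ⟨-(Polynomial.eval₂ (aeval a : MvPolynomial (Fin n) ℝ →ₐ[ℝ] Poly2).toRingHom f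
      Q'.divX), ?_⟩
    have : (aeval a) (Q'.coeff 0) = (aeval a : MvPolynomial (Fin n) ℝ →ₐ[ℝ] Poly2).toRingHom
      (Q'.coeff 0) := rfl
    rw [this]
    linear_combination h0

/-- Three plane polynomials are algebraically dependent. -/
lemma exists_aeval_eq_zero_of_three (a : Fin 3 → Poly2) :
    ∃ q : MvPolynomial (Fin 3) ℝ, q ≠ 0 ∧ aeval a q = 0 := by
  by_contra! hcon
  have hind : AlgebraicIndependent ℝ a := by
    rw [algebraicIndependent_iff]
    intro p hp
    by_contra hne
    exact hcon p hne hp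
  have := hind.cardinalMk_le_trdeg
  rw [MvPolynomial.trdeg_of_isDomain] at this
  norm_num at this

/-- A derivation of `ℝ[x, y]` along the level sets of `f`. -/
noncomputable def tangentDer (f : Poly2) : Derivation ℝ Poly2 Poly2 :=
  pderiv 1 f • pderiv 0 - pderiv 0 f • pderiv 1

lemma tangentDer_apply (f g : Poly2) :
    tangentDer f g = pderiv 1 f * pderiv 0 g - pderiv 0 f * pderiv 1 g := by
  simp [tangentDer]

/-- The derivation kills `f`, so it descends to the quotient `ℝ[x, y] / (f)`. -/
lemma dvd_tangentDer {f g : Poly2} (h : f ∣ g) : f ∣ tangentDer f g := by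
  obtain ⟨q, rfl⟩ := h
  refine ⟨tangentDer f q, ?_⟩
  simp only [tangentDer_apply, Derivation.leibniz, smul_eq_mul]
  ring

lemma totalDegree_pderiv_lt {f : Poly2} {d : Fin 2} (h : pderiv d f ≠ 0) :
    (pderiv d f).totalDegree < f.totalDegree := by
  have hne : (pderiv d f).support.Nonempty := 
    Finset.nonempty_iff_ne_empty.mpr (fun h' => h (MvPolynomial.support_eq_empty.mp h'))
  obtain ⟨m, hm, hmax⟩ := Finset.exists_mem_eq_sup _ hne (fun s : Fin 2 →₀ ℕ => s.sum fun _ e => e)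
  have hmc : coeff m (pderiv d f) ≠ 0 := by simpa using hm
  rw [coeff_pderiv] at hmc
  have hm' : m + Finsupp.single d 1 ∈ f.support := by
    rw [mem_support_iff]; intro h0; rw [h0] at hmc; simp at hmc
  have h1 := le_totalDegree hm'
  rw [Finsupp.sum_add_index' (by simp) (by simp)] at h1
  simp only [Finsupp.sum_single_index] at h1
  have : (pderiv d f).totalDegree = m.sum fun _ e => e := hmax
  omega

lemma not_dvd_pderiv {f : Poly2} {d : Fin 2} (h : pderiv d f ≠ 0) : ¬ f ∣ pderiv d f := by
  rintro ⟨g, hg⟩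
  have h1 := totalDegree_pderiv_lt h
  rw [hg] at h h1
  rw [totalDegree_mul_of_isDomain (left_ne_zero_of_mul h) (right_ne_zero_of_mul h)] at h1
  omega

lemma eq_zero_of_pderiv_eq_zero {f : Poly2} {d : Fin 2} (h : pderiv d f = 0) {m : Fin 2 →₀ ℕ}
    (hm : m ∈ f.support) : m d = 0 := by
  by_contra hd
  have hc := coeff_pderiv (p := f) (m := m - Finsupp.single d 1) (i := d)
  have hle : Finsupp.single d 1 ≤ m := by
    rw [Finsupp.single_le_iff]; omega
  rw [h, tsub_add_cancel_of_le hle] at hc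
  simp only [coeff_zero] at hc
  rcases mul_eq_zero.mp hc.symm with h | h
  · exact (mem_support_iff.mp hm) h
  · have : (0:ℝ) ≤ ((m - Finsupp.single d 1 : Fin 2 →₀ ℕ) d : ℕ) := Nat.cast_nonneg _
    linarith

lemma eq_C_of_pderiv_eq_zero {f : Poly2} (h0 : pderiv 0 f = 0) (h1 : pderiv 1 f = 0) :
    ∃ c, f = C c := by
  refine ⟨coeff 0 f, ?_⟩
  ext m
  rw [coeff_C]
  split_ifs with hm
  · rw [← hm]
  · by_contra hc
    have hm' := mem_support_iff.mpr hc
    refine hm (Finsupp.ext fun d => ?_)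
    fin_cases d
    · exact (eq_zero_of_pderiv_eq_zero h0 hm').symm
    · exact (eq_zero_of_pderiv_eq_zero h1 hm').symm

lemma exists_pderiv_ne_zero {f : Poly2} (hf : Irreducible f) : ∃ d, pderiv d f ≠ 0 := by
  by_contra! hc
  obtain ⟨c, rfl⟩ := eq_C_of_pderiv_eq_zero (hc 0) (hc 1)
  have hc0 : c ≠ 0 := by rintro rfl; exact hf.ne_zero (by simp)
  exact hf.not_isUnit ((isUnit_iff_ne_zero.mpr hc0).map C)

lemma derivation_aeval_cons (δ : Derivation ℝ Poly2 Poly2) (x H : Poly2)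
    (p : MvPolynomial (Fin 2) ℝ) :
    δ (aeval ![x, H] p) = aeval ![x, H] (pderiv 0 p) * δ x + aeval ![x, H] (pderiv 1 p) * δ H := by
  induction p using MvPolynomial.induction_on with
  | C c => simp
  | add p q hp hq => simp only [map_add, hp, hq]; ring
  | mul_X p i hp =>
    simp only [map_mul, Derivation.leibniz, hp, smul_eq_mul, map_add]
    fin_cases i <;> simp [pderiv_X] <;> ring

/-- A polynomial whose partial derivatives are divisible by an irreducible `f` is algebraic over
the constants modulo `f`. -/
lemma exists_dvd_aeval {f H : Poly2} (hf : Irreducible f) (hH : ∀ d, f ∣ pderiv d H) :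
    ∃ m : Polynomial ℝ, m ≠ 0 ∧ f ∣ Polynomial.aeval H m := by
  have hprime : Prime f := hf.prime
  -- Here `x` is whichever coordinate is not killed modulo `f`; a non-zero partial of `f` has
  -- smaller degree, so `f` cannot divide it.
  obtain ⟨x, hx⟩ : ∃ x : Poly2, ¬ f ∣ tangentDer f x := by
    obtain ⟨d, hd⟩ := exists_pderiv_ne_zero hf
    have hnd := not_dvd_pderiv hd
    fin_cases d
    · exact ⟨X 1, by simpa [tangentDer_apply, pderiv_X] using hnd⟩
    · exact ⟨X 0, by simpa [tangentDer_apply, pderiv_X] using hnd⟩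
  have hδH : f ∣ tangentDer f H := by
    rw [tangentDer_apply]
    exact dvd_sub ((hH 0).mul_left _) ((hH 1).mul_left _)
  obtain ⟨q, hq, hq0⟩ := exists_aeval_eq_zero_of_three ![f, x, H]
  obtain ⟨r, hr, hfr⟩ := exists_dvd_aeval_of_aeval_cons_eq_zero hf.ne_zero ![x, H] hq hq0
  classical
  have hex : ∃ N : ℕ, ∃ r : MvPolynomial (Fin 2) ℝ, r ≠ 0 ∧ f ∣ aeval ![x, H] r ∧
    r.totalDegree = N := ⟨_, r, hr, hfr, rfl⟩
  obtain ⟨r, hr, hfr, hrN⟩ := Nat.find_spec hex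
  have hmin := fun m hm => Nat.find_min hex (m := m) hm
  rw [← hrN] at hmin
  -- Modulo `f`, differentiating `r(x, H) ≡ 0` leaves `(∂₀ r)(x, H) · δx ≡ 0` because `δH ≡ 0`. A
  -- non-zero `∂₀ r` would be a relation of smaller degree, so `r` involves `H` alone.
  have hr' : pderiv 0 r = 0 := by
    by_contra hne
    refine hmin _ (totalDegree_pderiv_lt hne) ⟨_, hne, ?_, rfl⟩
    have h1 := dvd_tangentDer hfr
    rw [derivation_aeval_cons] at h1
    have h2 := (dvd_add_left (hδH.mul_left _)).mp h1
    exact (hprime.dvd_or_dvd h2).resolve_right hx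
  have hvars : (r.vars : Set (Fin 2)) ⊆ Set.range (fun _ : Unit => (1 : Fin 2)) := by
    intro i hi
    obtain ⟨m, hm, hmi⟩ := mem_vars_iff_mem_support i |>.mp hi
    have hi0 : i ≠ 0 := by
      rintro rfl
      exact (Finsupp.mem_support_iff.mp hmi) (eq_zero_of_pderiv_eq_zero hr' hm)
    exact ⟨(), by fin_cases i <;> simp_all⟩
  obtain ⟨r', rfl⟩ := exists_rename_eq_of_vars_subset_range r _
    (fun _ _ _ => rfl) hvars
  refine ⟨uniqueAlgEquiv ℝ Unit r', ?_, ?_⟩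
  · rintro h0
    apply hr
    rw [(map_eq_zero_iff _ (uniqueAlgEquiv ℝ Unit).injective).mp h0, map_zero]
  · have : Polynomial.aeval H (uniqueAlgEquiv ℝ Unit r') =
        aeval ![x, H] (rename (fun _ : Unit => (1 : Fin 2)) r') := by
      rw [aeval_rename, Polynomial.aeval_def, eval₂_const_uniqueAlgEquiv, aeval_def]
      rfl
    rwa [this]

lemma exists_irreducible_dvd_aeval {f H : Poly2} (hf : Irreducible f)
    (hH : ∀ d, f ∣ pderiv d H) :
    ∃ m : Polynomial ℝ, Irreducible m ∧ f ∣ Polynomial.aeval H m := by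
  obtain ⟨m, hm, hfm⟩ := exists_dvd_aeval hf hH
  have hprime : Prime f := hf.prime
  induction m using WfDvdMonoid.induction_on_irreducible with
  | zero => exact absurd rfl hm
  | unit u hu => exact absurd (isUnit_of_dvd_unit hfm (hu.map _)) hf.not_isUnit
  | mul a p ha hp ih =>
    rw [map_mul] at hfm
    rcases hprime.dvd_or_dvd hfm with h | h
    · exact ⟨p, hp, h⟩
    · exact ih ha h

/-- Up to an affine change of `H`, an irreducible polynomial over the critical points of `H` divides
`H` or `H ^ 2 + 1`. -/
lemma exists_dvd_affine {f H : Poly2} (hf : Irreducible f) (hH : ∀ d, f ∣ pderiv d H) :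
    ∃ a b : ℝ, a ≠ 0 ∧ (f ∣ C a * H + C b ∨ f ∣ (C a * H + C b) ^ 2 + 1) := by
  obtain ⟨m, hm, hfm⟩ := exists_irreducible_dvd_aeval hf hH
  have hdeg := hm.natDegree_le_two
  have hpos := hm.natDegree_pos
  rw [Polynomial.aeval_eq_sum_range] at hfm
  obtain hd | hd : m.natDegree = 1 ∨ m.natDegree = 2 := by omega
  · refine ⟨m.coeff 1, m.coeff 0, ?_, Or.inl ?_⟩
    · rw [← hd]; simpa using hm.ne_zero
    · rw [hd] at hfm
      simp only [Finset.sum_range_succ, smul_eq_C_mul] at hfm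
      convert hfm using 1
      simp; ring
  · have hc2 : m.coeff 2 ≠ 0 := by rw [← hd]; simpa using hm.ne_zero
    set a := m.coeff 2
    set b := m.coeff 1
    set c := m.coeff 0
    have hmeq : m = Polynomial.C a * Polynomial.X ^ 2 + Polynomial.C b * Polynomial.X
        + Polynomial.C c := Polynomial.eq_quadratic_of_degree_le_two
          (Polynomial.natDegree_le_iff_degree_le.mp hdeg)
    have hdisc : 0 < 4 * a * c - b ^ 2 := by
      by_contra hneg
      have hroot : m.IsRoot ((-b + Real.sqrt (b ^ 2 - 4 * a * c)) / (2 * a)) := by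
        have hs := Real.sq_sqrt (show 0 ≤ b ^ 2 - 4 * a * c by linarith)
        set s := Real.sqrt (b ^ 2 - 4 * a * c)
        rw [Polynomial.IsRoot, hmeq]
        simp only [Polynomial.eval_add, Polynomial.eval_mul, Polynomial.eval_C,
          Polynomial.eval_pow, Polynomial.eval_X]
        field_simp
        linear_combination hs
      have := Polynomial.degree_eq_one_of_irreducible_of_root hm hroot
      rw [Polynomial.degree_eq_natDegree hm.ne_zero, hd] at this
      norm_num at this
    set w := Real.sqrt (4 * a * c - b ^ 2)
    have hw0 : w ≠ 0 := (Real.sqrt_pos.mpr hdisc).ne'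
    have hw : w ^ 2 = 4 * a * c - b ^ 2 := Real.sq_sqrt hdisc.le
    -- Completing the square: `(2aH + b)² + w² = 4a(aH² + bH + c)`, divided by `w²`.
    refine ⟨2 * a / w, b / w, by positivity, Or.inr ?_⟩
    have : (C (2 * a / w) * H + C (b / w)) ^ 2 + 1
        = C (4 * a / w ^ 2) * (C a * H ^ 2 + C b * H + C c) := by
      have e1 : (1 : Poly2) = C ((4 * a * c - b ^ 2) / w ^ 2) := by
        rw [← hw, div_self (pow_ne_zero 2 hw0), map_one]
      rw [e1]
      have e2 : (2 * a / w) ^ 2 = 4 * a / w ^ 2 * a := by field_simp; ring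
      have e3 : 2 * (2 * a / w) * (b / w) = 4 * a / w ^ 2 * b := by field_simp; ring
      have e4 : (b / w) ^ 2 + (4 * a * c - b ^ 2) / w ^ 2 = 4 * a / w ^ 2 * c := by
        field_simp; ring
      replace e2 := congrArg (C : ℝ → Poly2) e2
      replace e3 := congrArg (C : ℝ → Poly2) e3
      replace e4 := congrArg (C : ℝ → Poly2) e4
      simp only [map_mul, map_add, map_pow, map_ofNat] at e2 e3 e4
      linear_combination H ^ 2 * e2 + H * e3 + e4
    rw [this]
    refine Dvd.dvd.mul_left ?_ _
    rw [hd] at hfm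
    simp only [Finset.sum_range_succ, smul_eq_C_mul] at hfm
    convert hfm using 1
    simp; ring

/-! ### Multiple factors -/

/-- An irreducible polynomial dividing `W` and its partial derivatives divides `W` twice. -/
lemma sq_dvd_of_dvd_pderiv {f W : Poly2} (hf : Irreducible f) (h : f ∣ W)
    (hd : ∀ d, f ∣ pderiv d W) : f ^ 2 ∣ W := by
  obtain ⟨g, rfl⟩ := h
  obtain ⟨d, hd0⟩ := exists_pderiv_ne_zero hf
  have h1 := hd d
  rw [Derivation.leibniz, smul_eq_mul, smul_eq_mul] at h1
  have h2 := (dvd_add_right (dvd_mul_right _ _)).mp h1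
  rw [sq]
  exact mul_dvd_mul_left f ((hf.prime.dvd_or_dvd h2).resolve_right (not_dvd_pderiv hd0))

/-- The factorization of a polynomial with a multiple irreducible factor, the last factor being a
multiple one. -/
lemma exists_factorization {f W : Poly2} (hW : W ≠ 0) (hf : Irreducible f) (h : f ^ 2 ∣ W) :
    ∃ (n : ℕ) (u : Fin (n + 1) → Poly2) (k : Fin (n + 1) → ℕ) (c : ℝ), c ≠ 0 ∧
      (∀ i, Irreducible (u i)) ∧ (∀ i j, i ≠ j → ¬ Associated (u i) (u j)) ∧
      (∀ i, 1 ≤ k i) ∧ 2 ≤ k (Fin.last n) ∧ C c * ∏ i, u i ^ k i = W := by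
  classical
  let : StrongNormalizationMonoid Poly2 :=
    UniqueFactorizationMonoid.strongNormalizationMonoid
  set M := UniqueFactorizationMonoid.normalizedFactors W
  have hle : 2 • ({normalize f} : Multiset Poly2) ≤ M := by
    have := (UniqueFactorizationMonoid.dvd_iff_normalizedFactors_le_normalizedFactors
      (pow_ne_zero 2 hf.ne_zero) hW).mp h
    rwa [UniqueFactorizationMonoid.normalizedFactors_pow,
      UniqueFactorizationMonoid.normalizedFactors_irreducible hf] at this
  have hcount : 2 ≤ M.count (normalize f) := by
    have := Multiset.count_le_of_le (normalize f) hle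
    simpa using this
  have hmem : normalize f ∈ M.toFinset := by
    rw [Multiset.mem_toFinset, ← Multiset.count_pos]; omega
  obtain ⟨n, hn⟩ : ∃ n, M.toFinset.card = n + 1 :=
    Nat.exists_eq_succ_of_ne_zero (Finset.card_ne_zero_of_mem hmem)
  let e₀ : Fin (n + 1) ≃ M.toFinset := (M.toFinset.equivFinOfCardEq hn).symm
  -- The swap puts the multiple factor in the last position.
  let e := (Equiv.swap (Fin.last n) (e₀.symm ⟨_, hmem⟩)).trans e₀
  have hlast : (e (Fin.last n) : Poly2) = normalize f := by simp [e]
  have hirr : ∀ i, Irreducible (e i : Poly2) := fun i =>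
    UniqueFactorizationMonoid.irreducible_of_normalized_factor _ (Multiset.mem_toFinset.mp (e i).2)
  obtain ⟨w, hw⟩ := UniqueFactorizationMonoid.prod_normalizedFactors hW
  obtain ⟨c, hc, hcw⟩ := isUnit_iff_eq_C_of_isReduced.mp w.isUnit
  refine ⟨n, fun i => e i, fun i => M.count (e i : Poly2), c, hc.ne_zero, hirr, ?_, ?_, ?_, ?_⟩
  · intro i j hij hass
    apply hij
    apply e.injective
    apply Subtype.ext
    have hi := UniqueFactorizationMonoid.normalize_normalized_factor _
      (Multiset.mem_toFinset.mp (e i).2)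
    have hj := UniqueFactorizationMonoid.normalize_normalized_factor _
      (Multiset.mem_toFinset.mp (e j).2)
    rw [← hi, ← hj]
    exact normalize_eq_normalize_iff_associated.mpr hass
  · intro i
    exact Multiset.count_pos.mpr (Multiset.mem_toFinset.mp (e i).2)
  · simpa only [hlast] using hcount
  · rw [e.prod_comp (fun x : M.toFinset => (x : Poly2) ^ M.count (x : Poly2)),
      Finset.prod_coe_sort M.toFinset (fun x => x ^ M.count x),
      ← Finset.prod_multiset_count, ← hcw, mul_comm]
    exact hw

end Algebra

/-! ### Cofactors, logarithmic derivatives and minimality -/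

section Core

/-- The derivation of `ℝ[x, y]` along the vector field `(P, Q)`. -/
noncomputable def lieDer (P Q : Poly2) : Derivation ℝ Poly2 Poly2 :=
  P • pderiv 0 + Q • pderiv 1

lemma lieDer_apply (P Q g : Poly2) :
    lieDer P Q g = pderiv 0 g * P + pderiv 1 g * Q := by
  simp [lieDer, mul_comm]

lemma isFirstIntegral_iff {P Q F : Poly2} :
    IsFirstIntegral P Q F ↔ (∀ c : ℝ, F ≠ C c) ∧ lieDer P Q F = 0 := by
  rw [lieDer_apply]; rfl

lemma Irreducible.ne_C {f : Poly2} (hf : Irreducible f) (c : ℝ) : f ≠ C c := by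
  rintro rfl
  rcases eq_or_ne c 0 with rfl | hc
  · exact hf.ne_zero (by simp)
  · exact hf.not_isUnit ((isUnit_iff_ne_zero.mpr hc).map C)

lemma totalDegree_pos_of_ne_C {f : Poly2} (hf : ∀ c : ℝ, f ≠ C c) : 0 < f.totalDegree := by
  by_contra h
  exact hf _ (totalDegree_eq_zero_iff_eq_C.mp (by omega))

lemma totalDegree_pow_eq {f : Poly2} (hf : f ≠ 0) (k : ℕ) :
    (f ^ k).totalDegree = k * f.totalDegree := by
  induction k with
  | zero => simp
  | succ k ih =>
    rw [pow_succ, totalDegree_mul_of_isDomain (pow_ne_zero _ hf) hf, ih]; ring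

lemma IsFirstIntegral.exists_cofactor {P Q F : Poly2} (hcop : IsRelPrime P Q)
    (hF : IsFirstIntegral P Q F) :
    ∃ R, R ≠ 0 ∧ pderiv 1 F = R * P ∧ pderiv 0 F = -(R * Q) := by
  obtain ⟨hne, h⟩ := hF
  suffices hs : ∃ R, pderiv 1 F = R * P ∧ pderiv 0 F = -(R * Q) by
    obtain ⟨R, h1, h0⟩ := hs
    refine ⟨R, ?_, h1, h0⟩
    rintro rfl
    obtain ⟨c, hc⟩ := eq_C_of_pderiv_eq_zero (f := F) (by simpa using h0) (by simpa using h1)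
    exact hne c hc
  have hdvd : P ∣ pderiv 1 F * Q := ⟨-pderiv 0 F, by linear_combination h⟩
  obtain ⟨R, hR⟩ := hcop.dvd_of_dvd_mul_right hdvd
  -- If `P = 0`, the quotient `R` is arbitrary, but `Q` is a unit and determines it.
  rcases eq_or_ne P 0 with rfl | hP
  · obtain ⟨q, rfl⟩ := isRelPrime_zero_left.mp hcop
    refine ⟨-pderiv 0 F * (↑q⁻¹ : Poly2), by rw [hR]; simp, ?_⟩
    rw [mul_assoc, Units.inv_mul]; ring
  · refine ⟨R, by rw [hR, mul_comm], ?_⟩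
    apply mul_right_cancel₀ hP
    rw [hR] at h
    linear_combination h

lemma lieDer_eq_zero_of_pow {P Q v : Poly2} (hv : v ≠ 0) {k : ℕ} (hk : 1 ≤ k)
    (h : lieDer P Q (v ^ k) = 0) : lieDer P Q v = 0 := by
  rw [Derivation.leibniz_pow, nsmul_eq_mul, smul_eq_mul] at h
  have hk0 : (k : Poly2) ≠ 0 := by exact_mod_cast (by omega : k ≠ 0)
  exact (mul_eq_zero.mp ((mul_eq_zero.mp h).resolve_left hk0)).resolve_left (pow_ne_zero _ hv)

/-- This is `δW / W = ∑ k_i δu_i / u_i` with denominators cleared, hence a polynomial identity that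
can be evaluated at zeros of the `u_i`. -/
lemma derivation_prod_pow_mul {ι : Type*} [DecidableEq ι] (δ : Derivation ℝ Poly2 Poly2)
    (s : Finset ι) (u : ι → Poly2) (k : ι → ℕ) :
    δ (∏ i ∈ s, u i ^ k i) * ∏ i ∈ s, u i =
      (∏ i ∈ s, u i ^ k i) * ∑ i ∈ s, (k i : Poly2) * δ (u i) * ∏ j ∈ s.erase i, u j := by
  induction s using Finset.induction_on with
  | empty => simp
  | insert a s ha ih =>
    have hpow : δ (u a ^ k a) * u a = u a ^ k a * (k a * δ (u a)) := by
      rw [Derivation.leibniz_pow, nsmul_eq_mul, smul_eq_mul]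
      rcases k a with _ | m
      · simp
      · rw [Nat.add_sub_cancel, pow_succ]; ring
    have herase : ∑ i ∈ s, (k i : Poly2) * δ (u i) * ∏ j ∈ (insert a s).erase i, u j =
        u a * ∑ i ∈ s, (k i : Poly2) * δ (u i) * ∏ j ∈ s.erase i, u j := by
      rw [Finset.mul_sum]
      refine Finset.sum_congr rfl fun i hi => ?_
      have hia : a ≠ i := by rintro rfl; exact ha hi
      rw [Finset.erase_insert_of_ne hia, Finset.prod_insert (by simp [ha])]
      ring
    rw [Finset.prod_insert ha, Finset.prod_insert ha, Finset.sum_insert ha, herase,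
      Finset.erase_insert ha, Derivation.leibniz, smul_eq_mul, smul_eq_mul]
    linear_combination (∏ i ∈ s, u i ^ k i) * (∏ i ∈ s, u i) * hpow + u a ^ k a * u a * ih

variable {n : ℕ} (u : Fin (n + 1) → Poly2) (k : Fin (n + 1) → ℕ)

lemma pderiv_prod_mul (d : Fin 2) :
    pderiv d (∏ i, u i ^ k i) * ∏ i, u i = (∏ i, u i ^ k i) * fullK u k d :=
  derivation_prod_pow_mul _ _ _ _

lemma pderiv_newU_mul (d : Fin 2) :
    pderiv d (newU u k) * ∏ i : Fin n, u i.castSucc = newU u k * headK u k d :=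
  derivation_prod_pow_mul _ _ (fun i : Fin n => u i.castSucc) (fun i : Fin n => k i.castSucc)

lemma pderiv_newV_mul (d : Fin 2) :
    pderiv d (newV u k) * u (Fin.last n) = newV u k * lastK u k d := by
  have := derivation_prod_pow_mul (pderiv d) {Fin.last n} u k
  simpa [newV, lastK] using this

lemma fullK_eq (d : Fin 2) :
    fullK u k d = headK u k d * u (Fin.last n) + (∏ i : Fin n, u i.castSucc) * lastK u k d := by
  rw [fullK, Fin.sum_univ_castSucc, headK, Finset.sum_mul]
  congr 1
  · refine Finset.sum_congr rfl fun i _ => ?_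
    have : Finset.univ.erase i.castSucc =
        insert (Fin.last n) ((Finset.univ.erase i).map Fin.castSuccEmb) := by
      ext j
      refine Fin.lastCases ?_ (fun j => ?_) j
      · simp [(Fin.castSucc_lt_last i).ne']
      · simp [(Fin.castSucc_lt_last j).ne]
    rw [this, Finset.prod_insert (by simp [Fin.castSucc_ne_last]), Finset.prod_map]
    simp only [Fin.coe_castSuccEmb]
    ring
  · have : Finset.univ.erase (Fin.last n) = Finset.univ.map Fin.castSuccEmb := by
      ext j
      refine Fin.lastCases ?_ (fun j => ?_) j
      · simp [Fin.castSucc_ne_last]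
      · simp [(Fin.castSucc_lt_last j).ne]
    rw [this, Finset.prod_map]
    simp only [Fin.coe_castSuccEmb, lastK]
    ring

variable {u k}

/-- With `L = ∏ u_i`, the logarithmic derivative shows that `W` divides `R L P` and `R L Q`, hence
`R L` by coprimality; `G` is the quotient `R L / W`. -/
lemma exists_fullK_eq {P Q R : Poly2} (hcop : IsRelPrime P Q) (hu : ∀ i, u i ≠ 0) (hR : R ≠ 0)
    (h1 : pderiv 1 (∏ i, u i ^ k i) = R * P) (h0 : pderiv 0 (∏ i, u i ^ k i) = -(R * Q)) :
    ∃ G, G ≠ 0 ∧ fullK u k 1 = G * P ∧ -fullK u k 0 = G * Q := by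
  have e1 := pderiv_prod_mul u k 1
  have e0 := pderiv_prod_mul u k 0
  rw [h1] at e1
  rw [h0] at e0
  have hL : ∏ i, u i ≠ 0 := Finset.prod_ne_zero_iff.mpr fun i _ => hu i
  have hW : ∏ i, u i ^ k i ≠ 0 := Finset.prod_ne_zero_iff.mpr fun i _ => pow_ne_zero _ (hu i)
  set W := ∏ i, u i ^ k i
  set L := ∏ i, u i
  obtain ⟨G, hG⟩ : W ∣ R * L := by
    classical
    let := UniqueFactorizationMonoid.toGCDMonoid Poly2
    have hd : W ∣ gcd (R * L * P) (R * L * Q) :=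
      dvd_gcd ⟨fullK u k 1, by linear_combination e1⟩ ⟨-fullK u k 0, by linear_combination -e0⟩
    have hassoc := (gcd_mul_left' (R * L) P Q)
    have hunit : IsUnit (gcd P Q) := gcd_isUnit_iff_isRelPrime.mpr hcop
    exact (hd.trans hassoc.dvd).trans ((associated_mul_unit_left _ _ hunit).dvd)
  refine ⟨G, ?_, ?_, ?_⟩
  · rintro rfl
    exact mul_ne_zero hR hL (by rw [hG, mul_zero])
  · apply mul_left_cancel₀ hW
    linear_combination -e1 + P * hG
  · apply mul_left_cancel₀ hW
    linear_combination e0 + Q * hG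

/-- Substituting `fullK_eq` for `G P` and `G Q`, the `K₁ K₂ u_p` terms cancel and the rest is `D`
times the product of the first factors. -/
lemma lieDer_newU {P Q G : Poly2} (hu : ∀ i, u i ≠ 0)
    (h1 : fullK u k 1 = G * P) (h0 : -fullK u k 0 = G * Q) :
    G * lieDer P Q (newU u k) = newU u k * detD u k := by
  have hL : ∏ i : Fin n, u i.castSucc ≠ 0 := Finset.prod_ne_zero_iff.mpr fun i _ => hu _
  apply mul_left_cancel₀ hL
  have e0 := pderiv_newU_mul u k 0
  have e1 := pderiv_newU_mul u k 1
  rw [fullK_eq] at h0 h1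
  rw [lieDer_apply, detD]
  linear_combination (G * P) * e0 + (G * Q) * e1 - newU u k * headK u k 0 * h1
    - newU u k * headK u k 1 * h0

lemma lieDer_newV {P Q G : Poly2} (hu : ∀ i, u i ≠ 0)
    (h1 : fullK u k 1 = G * P) (h0 : -fullK u k 0 = G * Q) :
    G * lieDer P Q (newV u k) = -(newV u k * detD u k) := by
  apply mul_left_cancel₀ (hu (Fin.last n))
  have e0 := pderiv_newV_mul u k 0
  have e1 := pderiv_newV_mul u k 1
  rw [fullK_eq] at h0 h1
  rw [lieDer_apply, detD]
  linear_combination (G * P) * e0 + (G * Q) * e1 - newV u k * lastK u k 0 * h1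
    - newV u k * lastK u k 1 * h0

lemma prod_eq_newU_mul_newV : ∏ i, u i ^ k i = newU u k * newV u k := by
  rw [Fin.prod_univ_castSucc, newU, newV]

/-- By minimality of `H`, the multiple factor is not a first integral. -/
lemma not_isFirstIntegral_last {P Q H : Poly2} (hH : IsMinimalFirstIntegral P Q H)
    (hirr : ∀ i, Irreducible (u i)) (hk : ∀ i, 1 ≤ k i) (hlast : 2 ≤ k (Fin.last n))
    (hW : ∏ i, u i ^ k i = H ∨ ∏ i, u i ^ k i = H ^ 2 + 1) :
    ¬ IsFirstIntegral P Q (u (Fin.last n)) := by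
  intro hv
  have hdeg := hH.2 _ hv
  have hHpos := totalDegree_pos_of_ne_C hH.1.1
  have hU0 : newU u k ≠ 0 := Finset.prod_ne_zero_iff.mpr fun i _ => pow_ne_zero _ (hirr _).ne_zero
  have hV0 : newV u k ≠ 0 := pow_ne_zero _ (hirr _).ne_zero
  have hWdeg := totalDegree_mul_of_isDomain hU0 hV0
  rw [← prod_eq_newU_mul_newV, newV, totalDegree_pow_eq (hirr _).ne_zero] at hWdeg
  have hmul : 2 * (u (Fin.last n)).totalDegree ≤ k (Fin.last n) * (u (Fin.last n)).totalDegree :=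
    Nat.mul_le_mul_right _ hlast
  rcases hW with hW | hW
  · rw [hW] at hWdeg
    omega
  · have hle : (H ^ 2 + 1).totalDegree ≤ 2 * H.totalDegree := by
      refine (totalDegree_add _ _).trans (max_le (totalDegree_pow _ _) ?_)
      simp
    rw [hW] at hWdeg
    -- Minimality gives `deg H ≤ deg u_p`, whereas `deg u + k_p deg u_p ≤ 2 deg H`; only `k_p = 2`
    -- with `u` constant remains.
    have hU : (newU u k).totalDegree = 0 := by omega
    have hk2 : k (Fin.last n) = 2 := by
      by_contra hne
      have : 3 * (u (Fin.last n)).totalDegree ≤ k (Fin.last n) * (u (Fin.last n)).totalDegree :=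
        Nat.mul_le_mul_right _ (by omega)
      omega
    rcases n with _ | n
    · rw [Fin.prod_univ_castSucc] at hW
      simp only [Finset.univ_eq_empty, Finset.prod_empty, one_mul, hk2] at hW
      -- Both factors of `u_p² - H² = 1` are units, so `H` would be constant.
      have hfac : (u (Fin.last 0) - H) * (u (Fin.last 0) + H) = 1 := by linear_combination hW
      obtain ⟨a, -, ha⟩ := isUnit_iff_eq_C_of_isReduced.mp (IsUnit.of_mul_eq_one _ hfac)
      obtain ⟨b, -, hb⟩ := isUnit_iff_eq_C_of_isReduced.mp
        (IsUnit.of_mul_eq_one _ ((mul_comm _ _).trans hfac))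
      refine hH.1.1 ((b - a) / 2) ?_
      have h2 : (C (2 : ℝ) : Poly2) * H = C 2 * C ((b - a) / 2) := by
        rw [← C_mul, mul_div_cancel₀ _ (two_ne_zero), C_sub, ← ha, ← hb, map_ofNat]
        ring
      exact mul_left_cancel₀ (by simp) h2
    · have hdvd : u (Fin.castSucc 0) ∣ newU u k :=
        (dvd_pow_self _ (by have := hk (Fin.castSucc 0); omega)).trans
          (Finset.dvd_prod_of_mem (fun i : Fin (n + 1) => u i.castSucc ^ k i.castSucc)
            (Finset.mem_univ 0))
      have hunit : IsUnit (newU u k) := by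
        have hc := totalDegree_eq_zero_iff_eq_C.mp hU
        rw [hc] at hU0 ⊢
        exact (isUnit_iff_ne_zero.mpr (by simpa using hU0)).map C
      exact (hirr _).not_isUnit (isUnit_of_dvd_unit hdvd hunit)

end Core

/-! ### Existence of the normal form -/

section Existence

lemma exists_isMinimalFirstIntegral {P Q : Poly2} (h : ∃ F, IsFirstIntegral P Q F) :
    ∃ H, IsMinimalFirstIntegral P Q H := by
  classical
  have hex : ∃ N : ℕ, ∃ F, IsFirstIntegral P Q F ∧ F.totalDegree = N := by
    obtain ⟨F, hF⟩ := h
    exact ⟨_, F, hF, rfl⟩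
  obtain ⟨H, hH, hN⟩ := Nat.find_spec hex
  exact ⟨H, hH, fun F' hF' => hN ▸ Nat.find_min' hex ⟨F', hF', rfl⟩⟩

lemma IsMinimalFirstIntegral.affine {P Q H : Poly2} (hH : IsMinimalFirstIntegral P Q H)
    {a : ℝ} (ha : a ≠ 0) (b : ℝ) : IsMinimalFirstIntegral P Q (C a * H + C b) := by
  refine ⟨⟨fun c hc => ?_, ?_⟩, fun F' hF' => ?_⟩
  · apply hH.1.1 (a⁻¹ * (c - b))
    have hi : (C a⁻¹ : Poly2) * C a = 1 := by rw [← C_mul, inv_mul_cancel₀ ha, C_1]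
    rw [C_mul, C_sub, ← hc]
    linear_combination -H * hi
  · have := hH.1.2
    simp only [map_add, pderiv_C_mul, pderiv_C]
    linear_combination C a * this
  · refine le_trans ?_ (hH.2 F' hF')
    refine (totalDegree_add _ _).trans (max_le ((totalDegree_mul _ _).trans ?_) ?_)
    · simp
    · simp

/-- A nonzero constant can be absorbed in the factors of a product of powers with a positive value. -/
lemma exists_prod_pow_eq {n : ℕ} (k : Fin (n + 1) → ℕ) (hk : ∀ i, 1 ≤ k i) {c : ℝ} (hc : c ≠ 0)
    (w : Fin (n + 1) → ℝ) (hw : 0 < c * ∏ i, w i ^ k i) :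
    ∃ b : Fin (n + 1) → ℝ, ∏ i, b i ^ k i = c := by
  suffices h : ∃ i, ∃ r : ℝ, r ^ k i = c by
    obtain ⟨i, r, hr⟩ := h
    refine ⟨Function.update 1 i r, ?_⟩
    rw [Finset.prod_eq_single i]
    · simpa using hr
    · intro j _ hj
      simp [Function.update_of_ne hj]
    · simp
  rcases hc.lt_or_gt with hneg | hpos
  · have hodd : ∃ i, Odd (k i) := by
      by_contra! hcon
      have : 0 ≤ ∏ i, w i ^ k i :=
        Finset.prod_nonneg fun i _ => (Nat.not_odd_iff_even.mp (hcon i)).pow_nonneg _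
      exact absurd hw (not_lt.mpr (mul_nonpos_of_nonpos_of_nonneg hneg.le this))
    obtain ⟨i, hi⟩ := hodd
    refine ⟨i, -((-c) ^ ((k i : ℝ)⁻¹)), ?_⟩
    rw [hi.neg_pow, Real.rpow_inv_natCast_pow (by linarith) (by have := hk i; omega), neg_neg]
  · exact ⟨0, c ^ ((k 0 : ℝ)⁻¹), Real.rpow_inv_natCast_pow hpos.le (by have := hk 0; omega)⟩

/-- The algebraic normal form: a minimal first integral `H` such that `H` or `H ^ 2 + 1` has a
multiple irreducible factor. -/
lemma exists_normal_form {P Q : Poly2} (hcop : IsRelPrime P Q)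
    (hint : ∃ F : Poly2, IsFirstIntegral P Q F) (hham : ¬ IsHamiltonian P Q) :
    ∃ (H : Poly2) (n : ℕ) (u : Fin (n + 1) → Poly2) (k : Fin (n + 1) → ℕ),
      IsMinimalFirstIntegral P Q H ∧
      (∀ i, Irreducible (u i)) ∧ (∀ i j, i ≠ j → ¬ Associated (u i) (u j)) ∧
      (∀ i, 1 ≤ k i) ∧ 2 ≤ k (Fin.last n) ∧
      (∏ i, u i ^ k i = H ∨ ∏ i, u i ^ k i = H ^ 2 + 1) := by
  obtain ⟨H₀, hH₀⟩ := exists_isMinimalFirstIntegral hint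
  obtain ⟨R, hR, h1, h0⟩ := hH₀.1.exists_cofactor hcop
  have hRu : ¬ IsUnit R := by
    intro hu
    obtain ⟨c, hc, rfl⟩ := isUnit_iff_eq_C_of_isReduced.mp hu
    have hi : (C c⁻¹ : Poly2) * C c = 1 := by rw [← C_mul, inv_mul_cancel₀ hc.ne_zero, C_1]
    refine hham ⟨C c⁻¹ * H₀, ?_, ?_⟩
    · rw [pderiv_C_mul, h1]; linear_combination -P * hi
    · rw [pderiv_C_mul, h0]; linear_combination -Q * hi
  obtain ⟨f, hf, hfR⟩ := WfDvdMonoid.exists_irreducible_factor hRu hR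
  have hfd : ∀ d, f ∣ pderiv d H₀ := by
    intro d
    fin_cases d
    · exact h0 ▸ (hfR.mul_right _).neg_right
    · exact h1 ▸ hfR.mul_right _
  obtain ⟨a, b, ha, hab⟩ := exists_dvd_affine hf hfd
  have hH₁ := hH₀.affine ha b
  have hfd₁ : ∀ d, f ∣ pderiv d (C a * H₀ + C b) := by
    intro d
    simp only [map_add, pderiv_C_mul, pderiv_C, add_zero]
    exact (hfd d).mul_left _
  generalize C a * H₀ + C b = H₁ at *
  rcases hab with hdvd | hdvd
  · have hne : H₁ ≠ 0 := fun h => hH₁.1.1 0 (by rw [h, C_0])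
    obtain ⟨n, u, k, c, hc, hu, hass, hk, hl, hprod⟩ :=
      exists_factorization hne hf (sq_dvd_of_dvd_pderiv hf hdvd hfd₁)
    -- In this case the constant is absorbed by rescaling `H`. For `H ^ 2 + 1` that is impossible;
    -- the factors absorb it, using positivity.
    refine ⟨C c⁻¹ * H₁ + C 0, n, u, k, hH₁.affine (inv_ne_zero hc) 0, hu, hass, hk, hl, Or.inl ?_⟩
    rw [← hprod, ← mul_assoc, ← C_mul, inv_mul_cancel₀ hc, C_1, C_0, one_mul, add_zero]
  · have heval : ∀ z, 0 < eval z (H₁ ^ 2 + 1) := by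
      intro z
      simp only [map_add, map_pow, map_one]
      positivity
    have hne : H₁ ^ 2 + 1 ≠ 0 := fun h => by
      have := heval 0
      rw [h, map_zero] at this
      exact lt_irrefl _ this
    have hfd₂ : ∀ d, f ∣ pderiv d (H₁ ^ 2 + 1) := by
      intro d
      rw [map_add, pderiv_one, add_zero, pderiv_pow]
      exact (hfd₁ d).mul_left _
    obtain ⟨n, u, k, c, hc, hu, hass, hk, hl, hprod⟩ :=
      exists_factorization hne hf (sq_dvd_of_dvd_pderiv hf hdvd hfd₂)
    have hpos := heval 0
    rw [← hprod] at hpos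
    simp only [map_mul, eval_C, map_prod, map_pow] at hpos
    obtain ⟨b, hb⟩ := exists_prod_pow_eq k hk hc _ hpos
    have hbu : ∀ i, Associated (u i) (C (b i) * u i) := by
      intro i
      have hb0 : b i ≠ 0 := by
        intro h0
        apply hc
        rw [← hb]
        refine Finset.prod_eq_zero (Finset.mem_univ i) ?_
        rw [h0, zero_pow (by have := hk i; omega)]
      exact (associated_unit_mul_left _ _ ((isUnit_iff_ne_zero.mpr hb0).map C)).symm
    refine ⟨H₁, n, fun i => C (b i) * u i, k, hH₁, fun i => (hbu i).irreducible (hu i),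
      fun i j hij h => hass i j hij (((hbu i).trans h).trans (hbu j).symm), hk, hl, Or.inr ?_⟩
    rw [← hprod, ← hb, map_prod, ← Finset.prod_mul_distrib]
    exact Finset.prod_congr rfl fun i _ => by rw [mul_pow, map_pow]

end Existence

/-! ### Time changes and linear equations along curves -/

section Analysis

open Set Filter Topology

lemma hasDerivAt_eval {γ : ℝ → Plane} {γ' : Plane} {t : ℝ} (h : HasDerivAt γ γ' t) (F : Poly2) :
    HasDerivAt (fun r => eval (γ r) F)
      (eval (γ t) (pderiv 0 F) * γ' 0 + eval (γ t) (pderiv 1 F) * γ' 1) t := by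
  rw [hasDerivAt_pi] at h
  induction F using MvPolynomial.induction_on with
  | C c => simpa using hasDerivAt_const t c
  | add p q hp hq =>
    simp only [map_add]
    exact (hp.add hq).congr_deriv (by ring)
  | mul_X p i hp =>
    simp only [map_mul, eval_X]
    refine (hp.mul (h i)).congr_deriv ?_
    fin_cases i <;> simp [pderiv_X] <;> ring

lemma continuous_eval_comp {γ : ℝ → Plane} {t : ℝ} (h : ContinuousAt γ t) (F : Poly2) :
    ContinuousAt (fun r => eval (γ r) F) t :=
  (MvPolynomial.continuous_eval F).continuousAt.comp h

/-- A continuous function without zeros on an open interval is the derivative of a change of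
time, whose inverse is differentiable. -/
lemma exists_timeChange {I : Set ℝ} (hI : IsOpenInterval I) {ρ : ℝ → ℝ}
    (hρ : ∀ t ∈ I, ContinuousAt ρ t) (hρ0 : ∀ t ∈ I, ρ t ≠ 0) :
    ∃ (J : Set ℝ) (σ τ : ℝ → ℝ), IsOpenInterval J ∧ BijOn σ I J ∧ BijOn τ J I ∧
      (∀ t ∈ I, τ (σ t) = t) ∧ (∀ s ∈ J, σ (τ s) = s) ∧
      (∀ t ∈ I, HasDerivAt σ (ρ t) t) ∧ ∀ s ∈ J, HasDerivAt τ (ρ (τ s))⁻¹ s := by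
  rcases I.eq_empty_or_nonempty with rfl | ⟨t₀, ht₀⟩
  · exact ⟨∅, id, id, hI, bijOn_empty _, bijOn_empty _, by simp, by simp, by simp, by simp⟩
  have hcont : ContinuousOn ρ I := fun t ht => (hρ t ht).continuousWithinAt
  let σ : ℝ → ℝ := fun t => ∫ r in t₀..t, ρ r
  have hσ : ∀ t ∈ I, HasStrictDerivAt σ (ρ t) t := fun t ht =>
    intervalIntegral.integral_hasStrictDerivAt_right
      ((hcont.mono (hI.2.uIcc_subset ht₀ ht)).intervalIntegrable)
      (hcont.stronglyMeasurableAtFilter hI.1 t ht) (hρ t ht)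
  -- Rolle's theorem: equal values of `σ` would force a zero of `ρ` in between.
  have hlt : ∀ a ∈ I, ∀ b ∈ I, a < b → σ a ≠ σ b := by
    intro a ha b hb hab heq
    have hsub : Icc a b ⊆ I := hI.2.out ha hb
    obtain ⟨c, hc, hc0⟩ := exists_hasDerivAt_eq_zero hab
      (fun t ht => (hσ t (hsub ht)).hasDerivAt.continuousAt.continuousWithinAt) heq
      (fun t ht => (hσ t (hsub (Ioo_subset_Icc_self ht))).hasDerivAt)
    exact hρ0 c (hsub (Ioo_subset_Icc_self hc)) hc0
  have hinj : InjOn σ I := by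
    intro a ha b hb hab
    rcases lt_trichotomy a b with h | h | h
    · exact absurd hab (hlt a ha b hb h)
    · exact h
    · exact absurd hab.symm (hlt b hb a ha h)
  have hbij : BijOn σ I (σ '' I) := hinj.bijOn_image
  have hleft : ∀ t ∈ I, Function.invFunOn σ I (σ t) = t := fun t ht => hinj.leftInvOn_invFunOn ht
  have hright : ∀ s ∈ σ '' I, σ (Function.invFunOn σ I s) = s := fun s hs =>
    Function.invFunOn_eq hs
  refine ⟨σ '' I, σ, Function.invFunOn σ I, ⟨?_, ?_⟩, hbij, ?_, hleft, hright,
    fun t ht => (hσ t ht).hasDerivAt, ?_⟩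
  · rw [isOpen_iff_mem_nhds]
    rintro _ ⟨t, ht, rfl⟩
    rw [← (hσ t ht).map_nhds_eq (hρ0 t ht)]
    exact image_mem_map (hI.1.mem_nhds ht)
  · have hpre : IsPreconnected I := isPreconnected_iff_ordConnected.mpr hI.2
    exact (hpre.image σ fun t ht =>
      (hσ t ht).hasDerivAt.continuousAt.continuousWithinAt).ordConnected
  · exact hbij.symm ⟨fun s hs => hright s hs, fun t ht => hleft t ht⟩
  · rintro _ ⟨t, ht, rfl⟩
    rw [hleft t ht]
    refine ((hσ t ht).to_local_left_inverse (hρ0 t ht) ?_).hasDerivAt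
    filter_upwards [hI.1.mem_nhds ht] with r hr using hleft r hr

/-- A solution of `f' = a f` on an open interval that vanishes at a point is zero. -/
lemma eqOn_zero_of_hasDerivAt {J : Set ℝ} (hJ : IsOpenInterval J) {f : ℝ → ℝ} {a : ℝ}
    (hf : ∀ s ∈ J, HasDerivAt f (a * f s) s) {s₀ : ℝ} (hs₀ : s₀ ∈ J) (h0 : f s₀ = 0) :
    ∀ s ∈ J, f s = 0 := by
  intro s hs
  -- The integrating factor `exp (-a r)` makes the product constant.
  have hg : ∀ r ∈ J, HasDerivAt (fun r => f r * Real.exp (-(a * r))) 0 r := by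
    intro r hr
    have he : HasDerivAt (fun r : ℝ => Real.exp (-(a * r))) (Real.exp (-(a * r)) * -(a * 1)) r :=
      ((hasDerivAt_id r).const_mul a).neg.exp
    exact ((hf r hr).mul he).congr_deriv (by ring)
  have hconv : Convex ℝ J := hJ.2.convex
  have hd : DifferentiableOn ℝ (fun r => f r * Real.exp (-(a * r))) J :=
    fun r hr => (hg r hr).differentiableAt.differentiableWithinAt
  have hconst := hJ.1.is_const_of_deriv_eq_zero hconv.isPreconnected hd
    (fun r hr => (hg r hr).deriv) hs hs₀
  simp only [h0, zero_mul] at hconst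
  exact (mul_eq_zero.mp hconst).resolve_right (Real.exp_pos _).ne'

lemma hasDerivAt_zero_of_eqOn_zero {J : Set ℝ} (hJ : IsOpenInterval J) {f : ℝ → ℝ} {f' s : ℝ}
    (hf : HasDerivAt f f' s) (hs : s ∈ J) (h0 : ∀ s ∈ J, f s = 0) : f' = 0 := by
  have : HasDerivAt f 0 s := (hasDerivAt_const s (0 : ℝ)).congr_of_eventuallyEq
    (Filter.eventuallyEq_of_mem (hJ.1.mem_nhds hs) h0)
  exact hf.unique this

variable {n : ℕ} {u : Fin (n + 1) → Poly2} {k : Fin (n + 1) → ℕ}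

/-- If a product of powers of polynomials satisfies `f' = a f` along a curve, so does, in
logarithmic form, the product of their logarithmic derivatives, even where factors vanish. -/
lemma sum_pderiv_eq_of_hasDerivAt_prod_pow {ι : Type*} [Fintype ι] [DecidableEq ι]
    {w : ι → Poly2} {m : ι → ℕ} (hw0 : ∀ i, w i ≠ 0) (hm : ∀ i, 1 ≤ m i) {J : Set ℝ}
    (hJ : IsOpenInterval J) {η : ℝ → Plane} (hη : ∀ s ∈ J, DifferentiableAt ℝ η s) {a : ℝ}
    (hw : ∀ s ∈ J, HasDerivAt (fun r => eval (η r) (∏ i, w i ^ m i))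
      (a * eval (η s) (∏ i, w i ^ m i)) s) {s : ℝ} (hs : s ∈ J) :
    eval (η s) (∑ i, (m i : Poly2) * pderiv 0 (w i) * ∏ j ∈ Finset.univ.erase i, w j) * deriv η s 0
      + eval (η s) (∑ i, (m i : Poly2) * pderiv 1 (w i) * ∏ j ∈ Finset.univ.erase i, w j) *
        deriv η s 1 = a * eval (η s) (∏ i, w i) := by
  have hlog : ∀ d, _ := fun d => congrArg (eval (η s))
    (derivation_prod_pow_mul (pderiv d) Finset.univ w m)
  have hderiv := fun F => hasDerivAt_eval (hη s hs).hasDerivAt F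
  by_cases h0 : eval (η s) (∏ i, w i ^ m i) = 0
  -- One zero makes the product of powers, hence `∏ w_i`, vanish on all of `J`, so the latter has
  -- zero derivative. At a zero of `w_i` both sums reduce to their `i`-th term, and the claim is
  -- `m_i` times that derivative.
  · have hz := eqOn_zero_of_hasDerivAt hJ hw hs h0
    have hz' : ∀ r ∈ J, eval (η r) (∏ i, w i) = 0 := by
      intro r hr
      have := hz r hr
      rw [map_prod, Finset.prod_eq_zero_iff] at this ⊢
      obtain ⟨i, hi, h⟩ := this
      rw [map_pow] at h
      exact ⟨i, hi, pow_eq_zero_iff (by have := hm i; omega) |>.mp h⟩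
    obtain ⟨i, -, hi⟩ := Finset.prod_eq_zero_iff.mp ((map_prod (eval (η s)) _ _).symm.trans
      (hz' s hs))
    have hdz := hasDerivAt_zero_of_eqOn_zero hJ (hderiv (∏ i, w i)) hs hz'
    have hsingle : ∀ (c : ι → ℕ) (d : Fin 2),
        eval (η s) (∑ i, (c i : Poly2) * pderiv d (w i) * ∏ j ∈ Finset.univ.erase i, w j)
        = c i * (eval (η s) (pderiv d (w i)) * eval (η s) (∏ j ∈ Finset.univ.erase i, w j)) := by
      intro c d
      rw [map_sum, Finset.sum_eq_single i]
      · simp [mul_assoc]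
      · intro j _ hj
        rw [map_mul, map_prod, Finset.prod_eq_zero (i := i) (by simp [hj.symm]) hi, mul_zero]
      · simp
    have hprod : ∀ d, pderiv d (∏ i, w i) =
        ∑ i, (((1 : ι → ℕ) i : ℕ) : Poly2) * pderiv d (w i) * ∏ j ∈ Finset.univ.erase i, w j := by
      intro d
      have h := derivation_prod_pow_mul (pderiv d) Finset.univ w 1
      simp only [Pi.one_apply, pow_one] at h
      rw [mul_comm] at h
      exact mul_left_cancel₀ (Finset.prod_ne_zero_iff.mpr fun i _ => hw0 i) h
    rw [hprod, hprod, hsingle, hsingle] at hdz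
    rw [hsingle, hsingle, hz' s hs]
    simp only [Pi.one_apply, Nat.cast_one, one_mul] at hdz
    linear_combination (m i : ℝ) * hdz
  · apply mul_left_cancel₀ h0
    have huniq := (hderiv (∏ i, w i ^ m i)).unique (hw s hs)
    have l0 := hlog 0
    have l1 := hlog 1
    rw [map_mul, map_mul] at l0 l1
    linear_combination (-deriv η s 0) * l0 - deriv η s 1 * l1 + eval (η s) (∏ i, w i) * huniq

lemma deriv_eq_of_saddle {P Q G : Poly2} (hu : ∀ i, u i ≠ 0) (hk : ∀ i, 1 ≤ k i)
    (h1 : fullK u k 1 = G * P) (h0 : -fullK u k 0 = G * Q) {J : Set ℝ} (hJ : IsOpenInterval J)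
    {η : ℝ → Plane} (hη : ∀ s ∈ J, DifferentiableAt ℝ η s)
    (hD : ∀ s ∈ J, eval (η s) (detD u k) ≠ 0)
    (hsad : ∀ s ∈ J, HasDerivAt (fun r => coordChange u k (η r))
      (saddle (coordChange u k (η s))) s) {s : ℝ} (hs : s ∈ J) :
    HasDerivAt η ((eval (η s) G / eval (η s) (detD u k)) • vecField P Q (η s)) s := by
  have hU : ∀ s ∈ J, HasDerivAt (fun r => eval (η r) (newU u k)) (1 * eval (η s) (newU u k)) s :=
    fun s hs => by simpa [coordChange, saddle] using hasDerivAt_pi.mp (hsad s hs) 0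
  have hV : ∀ s ∈ J, HasDerivAt (fun r => eval (η r) (newV u k)) (-1 * eval (η s) (newV u k)) s :=
    fun s hs => by simpa [coordChange, saddle] using hasDerivAt_pi.mp (hsad s hs) 1
  have eU := sum_pderiv_eq_of_hasDerivAt_prod_pow (w := fun i : Fin n => u i.castSucc)
    (m := fun i : Fin n => k i.castSucc) (fun i => hu _) (fun i => hk _) hJ hη hU hs
  have eV := sum_pderiv_eq_of_hasDerivAt_prod_pow (w := fun _ : Unit => u (Fin.last n))
    (m := fun _ : Unit => k (Fin.last n)) (fun i => hu _) (fun i => hk _) hJ hη (a := -1)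
    (by simpa [newV] using hV) hs
  change eval (η s) (headK u k 0) * _ + eval (η s) (headK u k 1) * _ = _ at eU
  have eV' : eval (η s) (lastK u k 0) * deriv η s 0 + eval (η s) (lastK u k 1) * deriv η s 1
      = -eval (η s) (u (Fin.last n)) := by
    simpa [lastK] using eV
  have g1 := congrArg (eval (η s)) h1
  have g0 := congrArg (eval (η s)) h0
  have hD' := hD s hs
  rw [fullK_eq] at g0 g1
  simp only [detD, map_sub, map_mul, map_add, map_neg] at g0 g1 hD' ⊢
  refine (hη s hs).hasDerivAt.congr_deriv (funext fun d => ?_)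
  fin_cases d
  · simp only [vecField, Pi.smul_apply, smul_eq_mul, Fin.zero_eta, Matrix.cons_val_zero]
    rw [div_mul_eq_mul_div, eq_div_iff hD', ← g1]
    -- Cramer's rule for the velocity; by `fullK_eq` the numerators are `G P` and, in the other
    -- coordinate, `G Q`.
    linear_combination eval (η s) (lastK u k 1) * eU - eval (η s) (headK u k 1) * eV'
  · simp only [vecField, Pi.smul_apply, smul_eq_mul, Fin.mk_one, Matrix.cons_val_one,
      Matrix.cons_val_fin_one]
    rw [div_mul_eq_mul_div, eq_div_iff hD', ← g0]
    linear_combination eval (η s) (headK u k 0) * eV' - eval (η s) (lastK u k 0) * eU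

lemma exists_timeChange_to_saddle {P Q G : Poly2} (hu : ∀ i, u i ≠ 0)
    (h1 : fullK u k 1 = G * P) (h0 : -fullK u k 0 = G * Q) (I : Set ℝ) (γ : ℝ → Plane)
    (hI : IsOpenInterval I) (hγ : SolvesOn (vecField P Q) γ I)
    (hreg : ∀ t ∈ I, γ t ∈ region (detD u k) G) :
    ∃ (J : Set ℝ) (η : ℝ → Plane), IsOpenInterval J ∧
      IsTimeChange (fun z => eval z (detD u k) / eval z G) γ I η J ∧
      SolvesOn (fun z => (eval z G / eval z (detD u k)) • vecField P Q z) η J ∧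
      ∀ s ∈ J, HasDerivAt (fun r => coordChange u k (η r)) (saddle (coordChange u k (η s))) s := by
  obtain ⟨J, σ, τ, hJ, hσ, hτ, hτσ, hστ, hσ', hτ'⟩ := exists_timeChange hI
    (ρ := fun t => eval (γ t) (detD u k) / eval (γ t) G)
    (fun t ht => (continuous_eval_comp (hγ t ht).continuousAt _).div
      (continuous_eval_comp (hγ t ht).continuousAt _) (hreg t ht).2)
    (fun t ht => div_ne_zero (hreg t ht).1 (hreg t ht).2)
  have hsol : SolvesOn (fun z => (eval z G / eval z (detD u k)) • vecField P Q z) (γ ∘ τ) J := by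
    intro s hs
    have := (hγ _ (hτ.mapsTo hs)).scomp s (hτ' s hs)
    rwa [inv_div] at this
  refine ⟨J, γ ∘ τ, hJ, ⟨σ, hσ, hσ', fun t ht => by simp [hτσ t ht]⟩, hsol, fun s hs => ?_⟩
  have hregs : (γ ∘ τ) s ∈ region (detD u k) G := hreg _ (hτ.mapsTo hs)
  have hU := hasDerivAt_eval (hsol s hs) (newU u k)
  have hV := hasDerivAt_eval (hsol s hs) (newV u k)
  have gU := congrArg (eval ((γ ∘ τ) s)) (lieDer_newU hu h1 h0)
  have gV := congrArg (eval ((γ ∘ τ) s)) (lieDer_newV hu h1 h0)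
  simp only [lieDer_apply, map_mul, map_add, map_neg] at gU gV
  generalize (γ ∘ τ) s = z at *
  have hD := hregs.1
  rw [hasDerivAt_pi]
  intro d
  fin_cases d
  · refine hU.congr_deriv ?_
    simp only [vecField, saddle, coordChange, Pi.smul_apply, smul_eq_mul, Matrix.cons_val_zero,
      Matrix.cons_val_one, Matrix.cons_val_fin_one, Fin.zero_eta]
    field_simp
    linear_combination gU
  · refine hV.congr_deriv ?_
    simp only [vecField, saddle, coordChange, Pi.smul_apply, smul_eq_mul, Matrix.cons_val_zero,
      Matrix.cons_val_one, Matrix.cons_val_fin_one, Fin.mk_one]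
    field_simp
    linear_combination gV

lemma exists_timeChange_of_saddle {P Q G : Poly2} (hu : ∀ i, u i ≠ 0) (hk : ∀ i, 1 ≤ k i)
    (h1 : fullK u k 1 = G * P) (h0 : -fullK u k 0 = G * Q) (J : Set ℝ) (η : ℝ → Plane)
    (hJ : IsOpenInterval J) (hη : ∀ s ∈ J, DifferentiableAt ℝ η s)
    (hreg : ∀ s ∈ J, η s ∈ region (detD u k) G)
    (hsad : ∀ s ∈ J, HasDerivAt (fun r => coordChange u k (η r))
      (saddle (coordChange u k (η s))) s) :
    ∃ (I : Set ℝ) (γ : ℝ → Plane), IsOpenInterval I ∧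
      IsTimeChange (fun z => eval z (detD u k) / eval z G) γ I η J ∧
      SolvesOn (vecField P Q) γ I := by
  have hsol := fun s hs => deriv_eq_of_saddle hu hk h1 h0 hJ hη (fun s hs => (hreg s hs).1) hsad
    (s := s) hs
  have hne : ∀ s ∈ J, eval (η s) G / eval (η s) (detD u k) ≠ 0 := fun s hs =>
    div_ne_zero (hreg s hs).2 (hreg s hs).1
  -- The time change is built from `τ` back to `t`, with density `G / D`, so its inverse has the
  -- required density `D / G`.
  obtain ⟨I, σ, τ, hI, hσ, hτ, hτσ, hστ, hσ', hτ'⟩ := exists_timeChange hJ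
    (ρ := fun s => eval (η s) G / eval (η s) (detD u k))
    (fun s hs => (continuous_eval_comp (hη s hs).continuousAt _).div
      (continuous_eval_comp (hη s hs).continuousAt _) (hreg s hs).1) hne
  refine ⟨I, η ∘ τ, hI, ⟨τ, hτ, fun t ht => ?_, fun t ht => rfl⟩, fun t ht => ?_⟩
  · have := hτ' t ht
    rwa [inv_div] at this
  · have := (hsol _ (hτ.mapsTo ht)).scomp t (hτ' t ht)
    rwa [smul_smul, inv_mul_cancel₀ (hne _ (hτ.mapsTo ht)), one_smul] at this

end Analysis

end PlanarSys

/-! ### Assembly -/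

theorem theoremD (P Q : Poly2) (hcop : IsRelPrime P Q)
    (hint : ∃ F : Poly2, IsFirstIntegral P Q F)
    (hham : ¬ IsHamiltonian P Q) :
    ∃ (H : Poly2) (n : ℕ) (u : Fin (n + 1) → Poly2) (k : Fin (n + 1) → ℕ) (G : Poly2),
      -- `H` or `H ^ 2 + 1`, with `H` minimal, is `u_1^{k_1} ⋯ u_p^{k_p}`, where `p = n + 1 > 1`
      IsMinimalFirstIntegral P Q H ∧ 1 ≤ n ∧
      (∀ i, Irreducible (u i)) ∧ (∀ i j, i ≠ j → ¬ Associated (u i) (u j)) ∧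
      (∀ i, 1 ≤ k i) ∧ (∃ i, 2 ≤ k i) ∧
      (∏ i, u i ^ k i = H ∨ ∏ i, u i ^ k i = H ^ 2 + 1) ∧
      -- the polynomials `D` and `G` that give the change of time
      detD u k ≠ 0 ∧ G ≠ 0 ∧
      fullK u k 1 = G * P ∧ -fullK u k 0 = G * Q ∧
      -- the orbits of the system become orbits of the saddle
      (∀ (I : Set ℝ) (γ : ℝ → Plane), IsOpenInterval I →
        SolvesOn (vecField P Q) γ I → (∀ t ∈ I, γ t ∈ region (detD u k) G) →
        ∃ (J : Set ℝ) (η : ℝ → Plane), IsOpenInterval J ∧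
          IsTimeChange (fun z => eval z (detD u k) / eval z G) γ I η J ∧
          SolvesOn (fun z => (eval z G / eval z (detD u k)) • vecField P Q z) η J ∧
          ∀ s ∈ J, HasDerivAt (fun r => coordChange u k (η r)) (saddle (coordChange u k (η s))) s) ∧
      -- the saddle, written in the variables `x, y`, becomes the system
      (∀ (J : Set ℝ) (η : ℝ → Plane), IsOpenInterval J →
        (∀ s ∈ J, DifferentiableAt ℝ η s) → (∀ s ∈ J, η s ∈ region (detD u k) G) →
        (∀ s ∈ J, HasDerivAt (fun r => coordChange u k (η r)) (saddle (coordChange u k (η s))) s) →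
        ∃ (I : Set ℝ) (γ : ℝ → Plane), IsOpenInterval I ∧
          IsTimeChange (fun z => eval z (detD u k) / eval z G) γ I η J ∧
          SolvesOn (vecField P Q) γ I) := by
  obtain ⟨H, n, u, k, hH, hirr, hass, hk, hlast, hW⟩ := exists_normal_form hcop hint hham
  have hu : ∀ i, u i ≠ 0 := fun i => (hirr i).ne_zero
  have hnot := not_isFirstIntegral_last hH hirr hk hlast hW
  have hWint : IsFirstIntegral P Q (∏ i, u i ^ k i) := by
    refine isFirstIntegral_iff.mpr ⟨fun c hc => ?_, ?_⟩
    · have hdvd : u (Fin.last n) ∣ C c := hc ▸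
        (dvd_pow_self _ (by omega)).trans
          (Finset.dvd_prod_of_mem (fun i => u i ^ k i) (Finset.mem_univ _))
      have hne : c ≠ 0 := by
        rintro rfl
        rw [C_0] at hc
        exact Finset.prod_ne_zero_iff.mpr (fun i _ => pow_ne_zero _ (hu i)) hc
      exact (hirr _).not_isUnit
        (isUnit_of_dvd_unit hdvd ((isUnit_iff_ne_zero.mpr hne).map C))
    · have h0 := (isFirstIntegral_iff.mp hH.1).2
      rcases hW with h | h
      · rw [h, h0]
      · rw [h, map_add, Derivation.leibniz_pow, h0]
        simp
  obtain ⟨R, hR, hR1, hR0⟩ := hWint.exists_cofactor hcop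
  obtain ⟨G, hG, h1, h0⟩ := exists_fullK_eq hcop hu hR hR1 hR0
  -- This excludes both `p = 1`, where `v = W` is a first integral, and `D = 0`, where `lieDer_newV`
  -- would make `v` one.
  have hlie : lieDer P Q (newV u k) ≠ 0 := fun h => hnot <| isFirstIntegral_iff.mpr
    ⟨(hirr _).ne_C, lieDer_eq_zero_of_pow (hu _) (hk _) h⟩
  refine ⟨H, n, u, k, G, hH, ?_, hirr, hass, hk, ⟨_, hlast⟩, hW, fun hD => ?_, hG, h1, h0,
    exists_timeChange_to_saddle hu h1 h0, exists_timeChange_of_saddle hu hk h1 h0⟩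
  · by_contra hn
    obtain rfl : n = 0 := by omega
    apply hlie
    have := (isFirstIntegral_iff.mp hWint).2
    rwa [prod_eq_newU_mul_newV, newU, Finset.univ_eq_empty, Finset.prod_empty, one_mul] at this
  · apply mul_ne_zero hG hlie
    rw [lieDer_newV hu h1 h0, hD, mul_zero, neg_zero]
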